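/- **Gasket and vertices.** Let $SG(n)$ be the two-dimensional Sierpinski gasket graph: $SG(0)$ is an upward equilateral triangle with unit sides, and $SG(n+1)$ is the union of three translated copies of $SG(n)$ placed at the lower left, the right and the top, neighbouring copies sharing a corner. All stages have the same leftmost vertex $o$; $a_n$ and $b_n$ are the rightmost and topmost vertices of $SG(n)$. For $m\ge 0$ let the triangle with address $(m)$ be the triangle with corners $o,a_{m+1},b_{m+1}$. Given a triangle with address $(m,\gamma_2,\dots,\gamma_{s-1})$, its lower left, right and top half-size triangles have addresses $(m,\gamma_2,\dots,\gamma_{s-1},\gamma_s)$ with $\gamma_s=0,1,2$ respectively. For $1\le s\le m+1$ and $\gamma=(m,\gamma_2,\dots,\gamma_s)$, let $a_\gamma,b_\gamma,c_\gamma$ be the midpoints of the bottom, left and right sides of the triangle with address $\gamma$; they are vertices of $SG(m+1)$. **Degree probabilities.** For a vertex $x$ of $SG(n)$, let $F_j(n,x)$ be the proportion of the spanning trees of $SG(n)$ that have exactly $j$ edges at $x$. Let $G_j(n,x)$ be the same proportion among the spanning subgraphs of $SG(n)$ consisting of exactly two trees, one containing $b_n$ and the other containing $o$ and $a_n$, and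 $H_j(n,x)$ the same proportion among the spanning subgraphs consisting of exactly three trees, with $o,a_n,b_n$ in three different ones. For $\gamma=(n-1,\gamma_2,\dots,\gamma_s)$ let $B_j(n,\gamma)$ be the $3\times5$ matrix whose rows, indexed by $x=a,b,c$ in this order, are $$\bigl(F_j(n,x_\gamma),\;G_j(n,x_\gamma),\;G_j(n,\tilde x_\gamma),\;G_j(n,\hat x_\gamma),\;H_j(n,x_\gamma)\bigr),$$ where $\tilde x_\gamma$ is the reflection of $x_\gamma$ that fixes $o$ and exchanges $a_n$ and $b_n$, and $\hat x_\gamma$ the reflection that fixes $a_n$ and exchanges $o$ and $b_n$. Put $$R=\begin{pmatrix}\frac23&\frac35&\frac1{10}&\frac35&\frac6{25}\\ \frac16&\frac3{10}&\frac1{10}&\frac1{10}&\frac7{50}\\ 0&0&\frac25&0&\frac6{25}\\ \frac16&\frac1{10}&\frac1{10}&\frac3{10}&\frac7{50}\\ 0&0&\frac3{10}&0&\frac6{25}\end{pmatrix},\qquad e_1=(1,0,0,0,0)^T,$$ let $E_1$ be the $5\times5$ identity matrix, $E_0$ the permutation matrix exchanging the third and fourth coordinates, and $E_2$ the permutation matrix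 exchanging the second and third coordinates. **Reduced address.** For $\gamma=(n,1,\gamma_3,\gamma_4,\dots,\gamma_s)$ put $\gamma^{t}=(n-1,1,\kappa_t(\gamma_4),\dots,\kappa_t(\gamma_s))$, where $t=\gamma_3$; here $\kappa_0$ exchanges the digits $0$ and $1$, $\kappa_1$ is the identity, and $\kappa_2$ exchanges $1$ and $2$. Let $P_t$ be the $3\times3$ permutation matrix acting on the rows indexed by $a,b,c$: $P_0$ exchanges the rows $b$ and $c$, $P_1$ is the identity, and $P_2$ exchanges the rows $a$ and $b$. **Proposition.** Let $n\ge2$, $3\le s\le n+1$, $\gamma=(n,1,\gamma_3,\dots,\gamma_s)$ with $\gamma_k\in\{0,1,2\}$ for $3\le k\le s$, and $j\in\{1,2,3,4\}$. Then $$\begin{pmatrix}F_j(n+1,a_\gamma)\\F_j(n+1,b_\gamma)\\F_j(n+1,c_\gamma)\end{pmatrix}=P_{\gamma_3}\,B_j\bigl(n,\gamma^{\gamma_3}\bigr)\,E_{\gamma_3}\,R\,e_1 .$$ -/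

import Mathlib

/-! Points of the triangular lattice are written in oblique coordinates: `(x, y)` stands for
`x • u + y • v`, where `u` and `v` are unit vectors at angle `π / 3`. -/

namespace Gasket

/-- The vertex set of `SG(n)`: a triangle for `n = 0`; stage `n + 1` is made of three translated
copies of stage `n`, with lower left corners `o = (0, 0)`, `a_n = (2 ^ n, 0)`, `b_n = (0, 2 ^ n)`. -/
def verts : ℕ → Set (ℤ × ℤ)
  | 0 => {(0, 0), (1, 0), (0, 1)}
  | n + 1 => verts n ∪ (fun p => p + (2 ^ n, 0)) '' verts n ∪ (fun p => p + (0, 2 ^ n)) '' verts n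

/-- The Sierpinski gasket `SG(n)`, as a graph drawn on the lattice. Its edges join points of
`verts n` only. -/
def SG : ℕ → SimpleGraph (ℤ × ℤ)
  | 0 => SimpleGraph.fromEdgeSet {s((0, 0), (1, 0)), s((0, 0), (0, 1)), s((1, 0), (0, 1))}
  | n + 1 => SG n ⊔ (SG n).map (fun p => p + (2 ^ n, 0)) ⊔ (SG n).map (fun p => p + (0, 2 ^ n))

/-- The leftmost vertex. -/
def o : ℤ × ℤ := (0, 0)

/-- The rightmost vertex `a_n` of `SG(n)`. -/
def cornerA (n : ℕ) : ℤ × ℤ := (2 ^ n, 0)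

/-- The topmost vertex `b_n` of `SG(n)`. -/
def cornerB (n : ℕ) : ℤ × ℤ := (0, 2 ^ n)

/-- `H` is (the edge set of) a spanning tree of `SG(n)`. -/
def IsSpanningTree (n : ℕ) (H : SimpleGraph (ℤ × ℤ)) : Prop :=
  H ≤ SG n ∧ (H.induce (verts n)).IsTree

/-- `H` is a spanning subgraph of `SG(n)` consisting of exactly `k` trees. -/
def IsSpanningForest (n k : ℕ) (H : SimpleGraph (ℤ × ℤ)) : Prop :=
  H ≤ SG n ∧ (H.induce (verts n)).IsAcyclic ∧
    Nat.card (H.induce (verts n)).ConnectedComponent = k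

/-- A spanning subgraph with two trees, one containing `b_n`, the other one `o` and `a_n`. -/
def IsTwoForest (n : ℕ) (H : SimpleGraph (ℤ × ℤ)) : Prop :=
  IsSpanningForest n 2 H ∧ H.Reachable o (cornerA n) ∧ ¬ H.Reachable o (cornerB n)

/-- A spanning subgraph with three trees, `o`, `a_n` and `b_n` being in different ones. -/
def IsThreeForest (n : ℕ) (H : SimpleGraph (ℤ × ℤ)) : Prop :=
  IsSpanningForest n 3 H ∧ ¬ H.Reachable o (cornerA n) ∧ ¬ H.Reachable o (cornerB n) ∧
    ¬ H.Reachable (cornerA n) (cornerB n)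

/-- The number of edges of `H` at `x`. -/
noncomputable def deg (H : SimpleGraph (ℤ × ℤ)) (x : ℤ × ℤ) : ℕ := (H.neighborSet x).ncard

/-- `F_j(n, x) = f_j(n, x) / f(n)`. -/
noncomputable def F (j n : ℕ) (x : ℤ × ℤ) : ℚ :=
  ({H | IsSpanningTree n H ∧ deg H x = j}.ncard : ℚ) / ({H | IsSpanningTree n H}.ncard : ℚ)

/-- `G_j(n, x) = g_j(n, x) / g(n)`. -/
noncomputable def G (j n : ℕ) (x : ℤ × ℤ) : ℚ :=
  ({H | IsTwoForest n H ∧ deg H x = j}.ncard : ℚ) / ({H | IsTwoForest n H}.ncard : ℚ)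

/-- `H_j(n, x) = h_j(n, x) / h(n)`. -/
noncomputable def H (j n : ℕ) (x : ℤ × ℤ) : ℚ :=
  ({K | IsThreeForest n K ∧ deg K x = j}.ncard : ℚ) / ({K | IsThreeForest n K}.ncard : ℚ)

/-- The offset, for a triangle of side two, of the lower left corner of its lower left (`0`),
right (`1`) and top (`2`) half-size triangle. -/
def subOffset : Fin 3 → ℤ × ℤ := ![(0, 0), (1, 0), (0, 1)]

/-- The midpoints of the sides of a triangle of side two with lower left corner `(0, 0)`:
`a` (index `0`) on the bottom side, `b` (index `1`) on the left, `c` (index `2`) on the right. -/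
def sideMid : Fin 3 → ℤ × ℤ := ![(1, 0), (0, 1), (1, 1)]

/-- The vertex `x_γ`, with letter `x` (`0`, `1`, `2` stand for `a`, `b`, `c`) and subscript
`γ = (m, γ₂, …, γ_s)`. The triangle named by `(m)` is `SG(m + 1)`, of side `2 ^ (m + 1)`, each
further component selects one of the three half-size triangles of the triangle reached so far, and
`a_γ`, `b_γ`, `c_γ` are the side midpoints of the triangle reached at the end.
This needs `s ≤ m + 1`; the last case is never used then. -/
def vertex (x : Fin 3) : ℕ → List (Fin 3) → ℤ × ℤ
  | m, [] => (2 ^ m : ℤ) • sideMid x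
  | m + 1, d :: γ => (2 ^ (m + 1) : ℤ) • subOffset d + vertex x m γ
  | 0, _ :: _ => 0

/-- Reflection in the line through `o` and `c_0`. -/
def tilde (p : ℤ × ℤ) : ℤ × ℤ := (p.2, p.1)

/-- Reflection in the line through `a_n` and `b_{n-1}`, which exchanges `o` and `b_n`. -/
def hat (n : ℕ) (p : ℤ × ℤ) : ℤ × ℤ := (p.1, 2 ^ n - p.1 - p.2)

/-- The matrix `B_j(N, γ)` for `γ = (m, γ₂, …, γ_s)`: the rows belong to `a_γ`, `b_γ`, `c_γ`. -/
noncomputable def B (j N m : ℕ) (γ : List (Fin 3)) : Matrix (Fin 3) (Fin 5) ℚ :=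
  Matrix.of fun x =>
    let v := vertex x m γ
    ![F j N v, G j N v, G j N (tilde v), G j N (hat (m + 1) v), H j N v]

def R : Matrix (Fin 5) (Fin 5) ℚ :=
  !![2/3, 3/5,  1/10, 3/5,  6/25;
     1/6, 3/10, 1/10, 1/10, 7/50;
     0,   0,    2/5,  0,    6/25;
     1/6, 1/10, 1/10, 3/10, 7/50;
     0,   0,    3/10, 0,    6/25]

/-- The matrices `E_0`, `E_1`, `E_2`. -/
def E : Fin 3 → Matrix (Fin 5) (Fin 5) ℚ :=
  ![!![1, 0, 0, 0, 0;
       0, 1, 0, 0, 0;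
       0, 0, 0, 1, 0;
       0, 0, 1, 0, 0;
       0, 0, 0, 0, 1],
    1,
    !![1, 0, 0, 0, 0;
       0, 0, 1, 0, 0;
       0, 1, 0, 0, 0;
       0, 0, 0, 1, 0;
       0, 0, 0, 0, 1]]

def e₁ : Fin 5 → ℚ := ![1, 0, 0, 0, 0]

/-- `γ_k ↦ γ_k^t`: `t = 0` exchanges `0` and `1`, `t = 1` changes nothing, `t = 2` exchanges
`1` and `2`. -/
def digitPerm : Fin 3 → Equiv.Perm (Fin 3) := ![Equiv.swap 0 1, 1, Equiv.swap 1 2]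

/-- The letter associated with the letter `x`: `t = 0` exchanges `b` and `c`, `t = 1` changes
nothing, `t = 2` exchanges `a` and `b`. -/
def letterPerm : Fin 3 → Equiv.Perm (Fin 3) := ![Equiv.swap 1 2, 1, Equiv.swap 0 1]

end Gasket

/-! `SG(n + 1)` consists of three copies of `SG(n)` arranged in a ring: copies `i` and `j` meet in
the single point `corner n i + corner n j`. A spanning tree must therefore break the ring in exactly
one copy. Two of its parts are spanning trees of `SG(n)`. The part in the remaining copy `i` is a
two-component forest separating the two junction corners of that copy, and its outer corner `i`
joins either component (`isSpanningTree_glue_iff`, `isSeparated_iff`).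

Let `f` count the spanning trees of `SG(n)` and `g` the two-component forests isolating a given
corner. Then `SG(n + 1)` has `6 f² g` spanning trees. At a point of the right copy that is not one
of its corners, the degree depends only on the part in that copy. If the ring is broken there,
corner `0` or corner `2` is isolated; otherwise that part is a tree. Division gives weights `2/3,
1/6, 1/6` (`F_succ`), the nonzero entries of the first column of `R`.

It remains to reflect the right copy so that digit `t` becomes `1` (`sym_vertex`). The reflection
permutes letters, digits and the isolated corner; the last effect is what `E t` records. -/

namespace SimpleGraph

/-! ### Forests supported on a finite set of vertices -/

variable {V : Type*} {H : SimpleGraph V} {S : Set V}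

lemma Reachable.mem_of_support_subset (hS : H.support ⊆ S) {x y : V} (h : H.Reachable x y)
    (hx : x ∈ S) : y ∈ S := by
  obtain ⟨w⟩ := h
  induction w with
  | nil => exact hx
  | cons hadj _ ih => exact ih (hS ⟨_, hadj.symm⟩)

lemma Walk.forall_mem_support_of_support_subset (hS : H.support ⊆ S) {x y : V} (w : H.Walk x y)
    (hx : x ∈ S) : ∀ z ∈ w.support, z ∈ S := fun z hz => by
  classical
  exact (w.takeUntil z hz).reachable.mem_of_support_subset hS hx

/-- A walk that starts in `S` cannot leave it, points outside `S` being isolated. This permits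
working with graphs on the whole lattice instead of induced ones. -/
lemma induce_reachable_iff_of_support_subset (hS : H.support ⊆ S) (x y : S) :
    (H.induce S).Reachable x y ↔ H.Reachable x y := by
  constructor
  · exact fun h => h.map (Embedding.induce S).toHom
  · rintro ⟨w⟩
    exact ⟨w.induce S (w.forall_mem_support_of_support_subset hS x.2)⟩

lemma induce_isAcyclic_iff_of_support_subset (hS : H.support ⊆ S) :
    (H.induce S).IsAcyclic ↔ H.IsAcyclic := by
  refine ⟨fun h v c hc => ?_, fun h => h.induce S⟩
  have hv : v ∈ S := hS ⟨_, c.adj_snd hc.not_nil⟩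
  have hmem := c.forall_mem_support_of_support_subset hS hv
  refine h (c.induce S hmem) (Walk.IsCycle.of_map (f := (Embedding.induce S).toHom) ?_)
  rw [Walk.map_induce]
  exact hc

lemma card_edgeSet_induce_of_support_subset (hS : H.support ⊆ S) :
    Nat.card (H.induce S).edgeSet = H.edgeSet.ncard := by
  have h : H.edgeSet = Sym2.map Subtype.val '' (H.induce S).edgeSet := by
    ext e
    induction e with | _ a b =>
    constructor
    · intro hab
      exact ⟨s(⟨a, hS ⟨_, hab⟩⟩, ⟨b, hS ⟨_, hab.symm⟩⟩), hab, rfl⟩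
    · rintro ⟨e, he, hab⟩
      induction e with | _ x y =>
      rw [← hab]
      exact he
  rw [h, Set.ncard_image_of_injective _ (Sym2.map.injective Subtype.val_injective),
    Nat.card_coe_set_eq]

/-- Turns acyclicity of a connected graph into an edge count, so that no cycle has to be traced
through a glued graph. -/
lemma isAcyclic_iff_ncard_edgeSet (hS : H.support ⊆ S) (hfin : S.Finite) (hne : S.Nonempty)
    (hreach : ∀ x ∈ S, ∀ y ∈ S, H.Reachable x y) :
    H.IsAcyclic ↔ H.edgeSet.ncard + 1 = S.ncard := by
  have : Finite S := hfin
  have : Nonempty S := hne.to_subtype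
  have hc : (H.induce S).Connected :=
    ⟨fun x y => (induce_reachable_iff_of_support_subset hS x y).2 (hreach x x.2 y y.2)⟩
  have h := isTree_iff_connected_and_card (G := H.induce S)
  rw [card_edgeSet_induce_of_support_subset hS, Nat.card_coe_set_eq] at h
  rw [← induce_isAcyclic_iff_of_support_subset hS]
  exact ⟨fun ha => (h.1 ⟨hc, ha⟩).2, fun hn => (h.2 ⟨hc, hn⟩).2⟩

/-- A new edge from `p` to `q` makes the forest a tree on `S`, with one edge more. -/
lemma IsAcyclic.ncard_edgeSet_of_not_reachable (ha : H.IsAcyclic) (hS : H.support ⊆ S)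
    (hfin : S.Finite) {p q : V} (hp : p ∈ S) (hq : q ∈ S) (hpq : ¬ H.Reachable p q)
    (hreach : ∀ x ∈ S, H.Reachable x p ∨ H.Reachable x q) :
    H.edgeSet.ncard + 2 = S.ncard := by
  have hne : p ≠ q := fun h => hpq (h ▸ Reachable.refl _)
  have hadj : (H ⊔ edge p q).Adj p q := Or.inr ((edge_adj ..).2 ⟨Or.inl ⟨rfl, rfl⟩, hne⟩)
  have hp' : ∀ x ∈ S, (H ⊔ edge p q).Reachable x p := fun x hx => by
    rcases hreach x hx with h | h
    · exact h.mono le_sup_left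
    · exact (h.mono le_sup_left).trans hadj.symm.reachable
  have hS' : (H ⊔ edge p q).support ⊆ S := by
    rintro x ⟨y, h | h⟩
    · exact hS ⟨y, h⟩
    · rw [edge_adj] at h
      rcases h.1 with h | h <;> rw [h.1] <;> assumption
  have h := (isAcyclic_iff_ncard_edgeSet hS' hfin ⟨p, hp⟩
    (fun x hx y hy => (hp' x hx).trans (hp' y hy).symm)).1 (ha.sup_edge_of_not_reachable hpq)
  have hfe : H.edgeSet.Finite := by
    refine ((hfin.prod hfin).image (fun z => s(z.1, z.2))).subset ?_
    intro e he
    induction e with | _ a b =>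
    exact ⟨(a, b), ⟨hS ⟨_, he⟩, hS ⟨_, he.symm⟩⟩, rfl⟩
  rw [edgeSet_sup, edgeSet_edge_of_ne hne, Set.union_singleton, Set.ncard_insert_of_notMem
    (fun he => hpq (Adj.reachable ((mem_edgeSet H).1 he))) hfe] at h
  exact h

end SimpleGraph

/-! ### Corners, copies and junctions of the gasket -/

namespace Gasket

open SimpleGraph

/-- The corners `o`, `a_n`, `b_n` of `SG(n)`. They are also the lower left corners of the three
copies of `SG(n)` in `SG(n + 1)`. -/
def corner (n : ℕ) (i : Fin 3) : ℤ × ℤ := (2 ^ n : ℤ) • subOffset i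

lemma corner_zero_right (n : ℕ) : corner n 0 = o := by simp [corner, subOffset, o]

lemma corner_one_right (n : ℕ) : corner n 1 = cornerA n := by simp [corner, subOffset, cornerA]

lemma corner_two_right (n : ℕ) : corner n 2 = cornerB n := by simp [corner, subOffset, cornerB]

lemma corner_succ (n : ℕ) (i : Fin 3) : corner (n + 1) i = corner n i + corner n i := by
  simp only [corner, pow_succ, mul_smul, two_smul, smul_add]

lemma corner_injective (n : ℕ) : Function.Injective (corner n) := by
  intro i j h
  fin_cases i <;> fin_cases j <;> simp_all [corner, subOffset] <;>
    exact absurd h (by positivity)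

lemma mem_verts_zero {p : ℤ × ℤ} : p ∈ verts 0 ↔ ∃ i, p = corner 0 i := by
  simp [verts, Fin.exists_fin_succ, corner, subOffset]

lemma mem_verts_succ {n : ℕ} {p : ℤ × ℤ} :
    p ∈ verts (n + 1) ↔ ∃ i, p - corner n i ∈ verts n := by
  have h (v : ℤ × ℤ) : p ∈ (fun p => p + v) '' verts n ↔ p - v ∈ verts n := by
    simp [← sub_eq_add_neg]
  simp only [verts, Set.mem_union, h, Fin.exists_fin_succ, corner, subOffset]
  simp [or_assoc, show ∀ p : ℤ × ℤ, p - (0, 0) = p from sub_zero]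

lemma SG_zero_adj {p q : ℤ × ℤ} :
    (SG 0).Adj p q ↔ p ≠ q ∧ (∃ i, p = corner 0 i) ∧ ∃ j, q = corner 0 j := by
  simp only [SG, fromEdgeSet_adj, Fin.exists_fin_succ, corner, subOffset]
  simp
  grind

lemma map_add_right_adj {K : SimpleGraph (ℤ × ℤ)} {v p q : ℤ × ℤ} :
    (K.map (fun p => p + v)).Adj p q ↔ K.Adj (p - v) (q - v) := by
  rw [map_adj']
  constructor
  · rintro ⟨-, a, b, h, rfl, rfl⟩
    simpa using h
  · intro h
    exact ⟨fun hpq => h.ne (by rw [hpq]), _, _, h, by simp, by simp⟩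

lemma SG_succ_adj {n : ℕ} {p q : ℤ × ℤ} :
    (SG (n + 1)).Adj p q ↔ ∃ i, (SG n).Adj (p - corner n i) (q - corner n i) := by
  simp only [SG, sup_adj, map_add_right_adj, Fin.exists_fin_succ, corner, subOffset]
  simp [or_assoc, show ∀ p : ℤ × ℤ, p - (0, 0) = p from sub_zero]

lemma support_SG_subset (n : ℕ) : (SG n).support ⊆ verts n := by
  induction n with
  | zero =>
    rintro p ⟨q, h⟩
    exact mem_verts_zero.2 (SG_zero_adj.1 h).2.1
  | succ n ih =>
    rintro p ⟨q, h⟩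
    obtain ⟨i, h⟩ := SG_succ_adj.1 h
    exact mem_verts_succ.2 ⟨i, ih ⟨_, h⟩⟩

lemma finite_verts (n : ℕ) : (verts n).Finite := by
  induction n with
  | zero => simp [verts]
  | succ n ih => exact (ih.union (ih.image _)).union (ih.image _)

lemma corner_mem_verts (n : ℕ) (i : Fin 3) : corner n i ∈ verts n := by
  induction n with
  | zero => exact mem_verts_zero.2 ⟨i, rfl⟩
  | succ n ih => exact mem_verts_succ.2 ⟨i, by simpa [corner_succ] using ih⟩

lemma verts_bounds {n : ℕ} {p : ℤ × ℤ} (hp : p ∈ verts n) :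
    0 ≤ p.1 ∧ 0 ≤ p.2 ∧ p.1 + p.2 ≤ 2 ^ n := by
  induction n generalizing p with
  | zero =>
    obtain ⟨i, rfl⟩ := mem_verts_zero.1 hp
    fin_cases i <;> simp [corner, subOffset]
  | succ n ih =>
    obtain ⟨i, h⟩ := mem_verts_succ.1 hp
    have h2 : (0 : ℤ) < 2 ^ n := by positivity
    have := ih h
    fin_cases i <;> simp [corner, subOffset] at this <;> rw [pow_succ] <;> omega

/-- By `verts_bounds` the copies lie in triangles that touch only at this point, which is corner `j`
of copy `i` and corner `i` of copy `j`. -/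
lemma eq_of_mem_copies {n : ℕ} {i j : Fin 3} (hij : i ≠ j) {p : ℤ × ℤ}
    (hi : p - corner n i ∈ verts n) (hj : p - corner n j ∈ verts n) :
    p = corner n i + corner n j := by
  have hi := verts_bounds hi
  have hj := verts_bounds hj
  obtain ⟨x, y⟩ := p
  fin_cases i <;> fin_cases j <;> simp_all [corner, subOffset] <;> omega

lemma ncard_verts_succ (n : ℕ) : (verts (n + 1)).ncard + 3 = 3 * (verts n).ncard := by
  set C : Fin 3 → Set (ℤ × ℤ) := fun i => (fun p => p + corner n i) '' verts n with hC
  have hmem (i p) : p ∈ C i ↔ p - corner n i ∈ verts n := by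
    simp [hC, ← sub_eq_add_neg]
  have hfin (i) : (C i).Finite := (finite_verts n).image _
  have hcard (i) : (C i).ncard = (verts n).ncard :=
    Set.ncard_image_of_injective _ (add_left_injective _)
  have hinter {i j} (hij : i ≠ j) : C i ∩ C j = {corner n i + corner n j} := by
    ext p
    simp only [Set.mem_inter_iff, hmem, Set.mem_singleton_iff]
    refine ⟨fun h => eq_of_mem_copies hij h.1 h.2, ?_⟩
    rintro rfl
    simp [corner_mem_verts]
  have hU : verts (n + 1) = C 0 ∪ C 1 ∪ C 2 := by
    ext p
    simp [mem_verts_succ, hmem, Fin.exists_fin_succ, or_assoc]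
  have h1 := Set.ncard_union_add_ncard_inter (C 0) (C 1) (hfin 0) (hfin 1)
  have h2 := Set.ncard_union_add_ncard_inter (C 0 ∪ C 1) (C 2) ((hfin 0).union (hfin 1)) (hfin 2)
  -- The third copy meets the other two in two distinct junctions; with the junction of copies `0`
  -- and `1`, three points are counted twice.
  rw [Set.union_inter_distrib_right, hinter (by decide), hinter (by decide), Set.singleton_union,
    Set.ncard_pair, ← hU] at h2
  · rw [hinter (by decide), Set.ncard_singleton] at h1
    simp only [hcard] at h1 h2
    omega
  · simpa using (corner_injective n).ne (by decide : (0 : Fin 3) ≠ 1)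

lemma finite_edgeSet_SG (n : ℕ) : (SG n).edgeSet.Finite := by
  refine (((finite_verts n).prod (finite_verts n)).image (fun z => s(z.1, z.2))).subset ?_
  intro e he
  induction e with | _ a b =>
  exact ⟨(a, b), ⟨support_SG_subset n ⟨_, he⟩, support_SG_subset n ⟨_, Adj.symm he⟩⟩, rfl⟩

lemma finite_le_SG (n : ℕ) : {K | K ≤ SG n}.Finite := by
  refine Set.Finite.of_finite_image (f := edgeSet) ?_ edgeSet_injective.injOn
  refine (finite_edgeSet_SG n).finite_subsets.subset ?_
  rintro _ ⟨K, hK, rfl⟩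
  exact edgeSet_mono hK

/-! ### Spanning trees and separated forests -/

lemma isSpanningTree_iff {n : ℕ} {K : SimpleGraph (ℤ × ℤ)} :
    IsSpanningTree n K ↔
      K ≤ SG n ∧ K.IsAcyclic ∧ ∀ x ∈ verts n, ∀ y ∈ verts n, K.Reachable x y := by
  refine and_congr_right fun hle => ?_
  have hS : K.support ⊆ verts n := (support_mono hle).trans (support_SG_subset n)
  rw [isTree_iff, induce_isAcyclic_iff_of_support_subset hS, and_comm]
  refine and_congr_right fun _ => ⟨fun h x hx y hy => ?_, fun h => ?_⟩
  · exact (induce_reachable_iff_of_support_subset hS ⟨x, hx⟩ ⟨y, hy⟩).1 (h.preconnected _ _)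
  · have : Nonempty (verts n) := ⟨⟨_, corner_mem_verts n 0⟩⟩
    exact ⟨fun x y =>
      (induce_reachable_iff_of_support_subset hS x y).2 (h x x.2 y y.2)⟩

/-- A spanning forest of `SG(n)` in which the two corners other than the `i`-th one lie in
different components, these being the only components. -/
def IsSeparated (n : ℕ) (i : Fin 3) (K : SimpleGraph (ℤ × ℤ)) : Prop :=
  K ≤ SG n ∧ K.IsAcyclic ∧
    (∀ j k, j ≠ i → k ≠ i → j ≠ k → ¬ K.Reachable (corner n j) (corner n k)) ∧
    ∀ x ∈ verts n, ∃ j ≠ i, K.Reachable x (corner n j)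

lemma exists_others (i : Fin 3) : ∃ j k : Fin 3, j ≠ i ∧ k ≠ i ∧ j ≠ k ∧
    ∀ l, l = i ∨ l = j ∨ l = k := by
  revert i
  decide

lemma IsSpanningTree.ncard_edgeSet {n : ℕ} {K : SimpleGraph (ℤ × ℤ)} (h : IsSpanningTree n K) :
    K.edgeSet.ncard + 1 = (verts n).ncard := by
  obtain ⟨hle, ha, hr⟩ := isSpanningTree_iff.1 h
  exact (isAcyclic_iff_ncard_edgeSet ((support_mono hle).trans (support_SG_subset n))
    (finite_verts n) ⟨_, corner_mem_verts n 0⟩ hr).1 ha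

lemma IsSeparated.ncard_edgeSet {n : ℕ} {i : Fin 3} {K : SimpleGraph (ℤ × ℤ)}
    (h : IsSeparated n i K) : K.edgeSet.ncard + 2 = (verts n).ncard := by
  obtain ⟨hle, ha, hn, hr⟩ := h
  obtain ⟨j, k, hj, hk, hjk, hall⟩ := exists_others i
  refine ha.ncard_edgeSet_of_not_reachable ((support_mono hle).trans (support_SG_subset n))
    (finite_verts n) (corner_mem_verts n j) (corner_mem_verts n k) (hn j k hj hk hjk) ?_
  intro x hx
  obtain ⟨l, hl, h⟩ := hr x hx
  rcases hall l with rfl | rfl | rfl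
  · exact absurd rfl hl
  · exact Or.inl h
  · exact Or.inr h

/-! ### Gluing forests on the three copies -/

/-- The union of three graphs placed on the three copies of `SG(n)` in `SG(n + 1)`. -/
def glue (n : ℕ) (K : Fin 3 → SimpleGraph (ℤ × ℤ)) : SimpleGraph (ℤ × ℤ) where
  Adj p q := ∃ i, (K i).Adj (p - corner n i) (q - corner n i)
  symm := ⟨fun _ _ ⟨i, h⟩ => ⟨i, h.symm⟩⟩
  loopless := ⟨fun _ ⟨_, h⟩ => h.ne rfl⟩

/-- The restriction of a graph to the `i`-th copy of `SG(n)` in `SG(n + 1)`, translated back. -/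
def part (n : ℕ) (K : SimpleGraph (ℤ × ℤ)) (i : Fin 3) : SimpleGraph (ℤ × ℤ) :=
  SG n ⊓ K.comap (fun p => p + corner n i)

section Glue

variable {n : ℕ} {K : Fin 3 → SimpleGraph (ℤ × ℤ)}

/-- Two copies share only one point, hence no edge. -/
lemma eq_of_adj_copies {i j : Fin 3} {p q : ℤ × ℤ}
    (hi : (SG n).Adj (p - corner n i) (q - corner n i))
    (hj : (SG n).Adj (p - corner n j) (q - corner n j)) : i = j := by
  by_contra hij
  have hp := eq_of_mem_copies hij (support_SG_subset n ⟨_, hi⟩) (support_SG_subset n ⟨_, hj⟩)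
  have hq := eq_of_mem_copies hij (support_SG_subset n ⟨_, hi.symm⟩)
    (support_SG_subset n ⟨_, hj.symm⟩)
  exact hi.ne (by rw [hp, hq])

lemma part_le (K : SimpleGraph (ℤ × ℤ)) (i : Fin 3) : part n K i ≤ SG n := inf_le_left

lemma glue_le (hK : ∀ i, K i ≤ SG n) : glue n K ≤ SG (n + 1) := by
  rintro p q ⟨i, h⟩
  exact SG_succ_adj.2 ⟨i, hK i h⟩

lemma glue_part {K : SimpleGraph (ℤ × ℤ)} (hK : K ≤ SG (n + 1)) : glue n (part n K) = K := by
  ext p q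
  constructor
  · rintro ⟨i, h⟩
    simpa using h.2
  · intro h
    obtain ⟨i, hi⟩ := SG_succ_adj.1 (hK h)
    exact ⟨i, hi, by simpa using h⟩

lemma part_glue (hK : ∀ i, K i ≤ SG n) : part n (glue n K) = K := by
  ext i p q
  constructor
  · rintro ⟨h, j, hj⟩
    have : i = j := eq_of_adj_copies (p := p + corner n i) (q := q + corner n i)
      (by simpa using h) (hK j hj)
    subst this
    simpa using hj
  · intro h
    exact ⟨hK i h, i, by simpa using h⟩

lemma glue_adj_add {i : Fin 3} {p q : ℤ × ℤ} (h : (K i).Adj p q) :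
    (glue n K).Adj (p + corner n i) (q + corner n i) := ⟨i, by simpa using h⟩

lemma glue_reachable_add {i : Fin 3} {p q : ℤ × ℤ} (h : (K i).Reachable p q) :
    (glue n K).Reachable (p + corner n i) (q + corner n i) :=
  h.map (⟨fun p => p + corner n i, fun h => glue_adj_add h⟩ : K i →g glue n K)

/-- A walk starting in copy `i` either stays there or passes through a junction; its segment before
the first exit lies in `K i`. -/
lemma reachable_or_of_glue_reachable (hK : ∀ i, K i ≤ SG n) {i : Fin 3} {x y : ℤ × ℤ}
    (h : (glue n K).Reachable x y) (hx : x - corner n i ∈ verts n) :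
    (y - corner n i ∈ verts n ∧ (K i).Reachable (x - corner n i) (y - corner n i)) ∨
      ∃ j ≠ i, (K i).Reachable (x - corner n i) (corner n j) := by
  rw [reachable_iff_reflTransGen] at h
  induction h with
  | refl => exact Or.inl ⟨hx, Reachable.refl _⟩
  | tail _ hyz ih =>
    rcases ih with ⟨hy, hr⟩ | h
    · obtain ⟨j, hj⟩ := hyz
      by_cases hji : j = i
      · subst hji
        exact Or.inl ⟨support_SG_subset n ⟨_, (hK j hj).symm⟩, hr.trans hj.reachable⟩
      · refine Or.inr ⟨j, hji, ?_⟩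
        rw [eq_of_mem_copies hji (support_SG_subset n ⟨_, hK j hj⟩) hy] at hr
        simpa using hr
    · exact Or.inr h

lemma ncard_edgeSet_glue (hK : ∀ i, K i ≤ SG n) :
    (glue n K).edgeSet.ncard = ∑ i, (K i).edgeSet.ncard := by
  have hinj (i) : Function.Injective (Sym2.map (fun p => p + corner n i)) :=
    Sym2.map.injective (add_left_injective _)
  have hmem (i p q) : s(p, q) ∈ Sym2.map (fun p => p + corner n i) '' (K i).edgeSet ↔
      (K i).Adj (p - corner n i) (q - corner n i) := by
    constructor
    · rintro ⟨e, he, h⟩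
      induction e with | _ a b =>
      rw [Sym2.map_mk, Sym2.eq_iff] at h
      rcases h with ⟨rfl, rfl⟩ | ⟨rfl, rfl⟩
      · simpa using he
      · simpa using he.symm
    · intro h
      exact ⟨s(_, _), h, by simp⟩
  have hU : (glue n K).edgeSet =
      ⋃ i, Sym2.map (fun p => p + corner n i) '' (K i).edgeSet := by
    ext e
    induction e with | _ p q =>
    simp only [Set.mem_iUnion, hmem]
    rfl
  rw [hU, Set.ncard_iUnion_of_finite, finsum_eq_sum_of_fintype]
  · exact Finset.sum_congr rfl fun i _ => Set.ncard_image_of_injective _ (hinj i)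
  · exact fun i => ((finite_edgeSet_SG n).subset (edgeSet_mono (hK i))).image _
  · intro i j hij
    refine Set.disjoint_left.2 fun e hi hj => hij ?_
    induction e with | _ p q =>
    exact eq_of_adj_copies (hK i ((hmem ..).1 hi)) (hK j ((hmem ..).1 hj))

/-- Every point of copy `i` is joined inside the copy to a junction. What remains open is whether
the two junctions are themselves joined there. -/
lemma isSpanningTree_or_isSeparated (hK : ∀ i, K i ≤ SG n)
    (h : IsSpanningTree (n + 1) (glue n K)) (i : Fin 3) :
    IsSpanningTree n (K i) ∨ IsSeparated n i (K i) := by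
  obtain ⟨-, ha, hr⟩ := isSpanningTree_iff.1 h
  have hai : (K i).IsAcyclic := ha.comap
    (⟨fun p => p + corner n i, fun h => glue_adj_add h⟩ : K i →g glue n K) (add_left_injective _)
  obtain ⟨j, k, hj, hk, hjk, hall⟩ := exists_others i
  have hri : ∀ x ∈ verts n, ∃ l ≠ i, (K i).Reachable x (corner n l) := by
    intro x hx
    have hx' : x + corner n i - corner n i ∈ verts n := by simpa using hx
    -- The outer corner `corner (n + 1) j` is a target outside copy `i`, so a walk to it has to
    -- exit.
    have := reachable_or_of_glue_reachable hK
      (hr _ (mem_verts_succ.2 ⟨i, hx'⟩) _ (corner_mem_verts (n + 1) j)) hx'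
    rw [add_sub_cancel_right] at this
    refine this.resolve_left fun hy => hj ?_
    have := eq_of_mem_copies hj (by simpa [corner_succ] using corner_mem_verts n j) hy.1
    rw [corner_succ, add_right_inj] at this
    exact corner_injective n this
  by_cases hjk' : (K i).Reachable (corner n j) (corner n k)
  · left
    have hj' : ∀ x ∈ verts n, (K i).Reachable x (corner n j) := by
      intro x hx
      obtain ⟨l, hl, hxl⟩ := hri x hx
      rcases hall l with rfl | rfl | rfl
      · exact absurd rfl hl
      · exact hxl
      · exact hxl.trans hjk'.symm
    exact isSpanningTree_iff.2 ⟨hK i, hai, fun x hx y hy => (hj' x hx).trans (hj' y hy).symm⟩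
  · refine Or.inr ⟨hK i, hai, ?_, hri⟩
    intro l m hl hm hlm h
    rcases hall l with rfl | rfl | rfl <;> rcases hall m with rfl | rfl | rfl <;>
      first | exact hl rfl | exact hm rfl | exact hlm rfl | exact hjk' h | exact hjk' h.symm

/-- The two trees meet in `corner n j + corner n k`, which serves as a hub. Each component of the
broken copy contains a junction and thereby reaches one of the trees. -/
lemma glue_reachable_of_isSeparated {i : Fin 3} (hi : IsSeparated n i (K i))
    (ht : ∀ j ≠ i, IsSpanningTree n (K j)) {x y : ℤ × ℤ} (hx : x ∈ verts (n + 1))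
    (hy : y ∈ verts (n + 1)) : (glue n K).Reachable x y := by
  obtain ⟨j, k, hj, hk, hjk, hall⟩ := exists_others i
  have htree {l} (hl : l ≠ i) {p q : ℤ × ℤ} (hp : p - corner n l ∈ verts n)
      (hq : q - corner n l ∈ verts n) : (glue n K).Reachable p q := by
    simpa using glue_reachable_add (n := n) ((isSpanningTree_iff.1 (ht l hl)).2.2 _ hp _ hq)
  have hout {l} (hl : l ≠ i) {p : ℤ × ℤ} (hp : p - corner n l ∈ verts n) :
      (glue n K).Reachable p (corner n j + corner n k) := by
    refine htree hl hp ?_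
    rcases hall l with rfl | rfl | rfl
    · exact absurd rfl hl
    · simpa using corner_mem_verts n k
    · simpa using corner_mem_verts n j
  have key : ∀ z ∈ verts (n + 1), (glue n K).Reachable z (corner n j + corner n k) := by
    intro z hz
    obtain ⟨l, hl⟩ := mem_verts_succ.1 hz
    by_cases hli : l = i
    · subst hli
      obtain ⟨m, hm, hr⟩ := hi.2.2.2 _ hl
      have hr := glue_reachable_add (n := n) hr
      rw [sub_add_cancel] at hr
      exact hr.trans (hout hm (by simpa using corner_mem_verts n l))
    · exact hout hli hl
  exact (key x hx).trans (key y hy).symm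

theorem isSpanningTree_glue_iff (hK : ∀ i, K i ≤ SG n) :
    IsSpanningTree (n + 1) (glue n K) ↔
      ∃ i, IsSeparated n i (K i) ∧ ∀ j ≠ i, IsSpanningTree n (K j) := by
  have hE := ncard_edgeSet_glue hK
  have hV := ncard_verts_succ n
  rw [Fin.sum_univ_three] at hE
  constructor
  · intro h
    have hH := h.ncard_edgeSet
    have key (i) : (IsSpanningTree n (K i) ∧ (K i).edgeSet.ncard + 1 = (verts n).ncard) ∨
        (IsSeparated n i (K i) ∧ (K i).edgeSet.ncard + 2 = (verts n).ncard) :=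
      (isSpanningTree_or_isSeparated hK h i).imp (fun h => ⟨h, h.ncard_edgeSet⟩)
        (fun h => ⟨h, h.ncard_edgeSet⟩)
    -- With `v` vertices per copy, the tree has `3v - 4` edges, while a tree part has `v - 1` and a
    -- separated part `v - 2`. So exactly one part is separated, and `omega` removes the other five
    -- cases.
    rcases key 0 with ⟨h0, e0⟩ | ⟨h0, e0⟩ <;> rcases key 1 with ⟨h1, e1⟩ | ⟨h1, e1⟩ <;>
      rcases key 2 with ⟨h2, e2⟩ | ⟨h2, e2⟩ <;> first
      | omega
      | exact ⟨0, h0, by simp [Fin.forall_fin_succ, h1, h2]⟩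
      | exact ⟨1, h1, by simp [Fin.forall_fin_succ, h0, h2]⟩
      | exact ⟨2, h2, by simp [Fin.forall_fin_succ, h0, h1]⟩
  · rintro ⟨i, hi, ht⟩
    have hr : ∀ x ∈ verts (n + 1), ∀ y ∈ verts (n + 1), (glue n K).Reachable x y :=
      fun x hx y hy => glue_reachable_of_isSeparated hi ht hx hy
    refine isSpanningTree_iff.2 ⟨glue_le hK, ?_, hr⟩
    -- Since connectedness is known, the same edge count yields acyclicity.
    rw [isAcyclic_iff_ncard_edgeSet ((support_mono (glue_le hK)).trans (support_SG_subset _))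
      (finite_verts _) ⟨_, corner_mem_verts _ 0⟩ hr, hE]
    have h2 := hi.ncard_edgeSet
    have h1 (j) (hj : j ≠ i) := (ht j hj).ncard_edgeSet
    fin_cases i
    · have := h1 1 (by decide); have := h1 2 (by decide); simp at h2; omega
    · have := h1 0 (by decide); have := h1 2 (by decide); simp at h2; omega
    · have := h1 0 (by decide); have := h1 1 (by decide); simp at h2; omega

end Glue

/-! ### Two-component forests isolating one corner -/

/-- A spanning forest of `SG(n)` with two components, one containing the `k`-th corner and the
other one the other two corners. -/
def IsCut (n : ℕ) (k : Fin 3) (K : SimpleGraph (ℤ × ℤ)) : Prop :=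
  K ≤ SG n ∧ K.IsAcyclic ∧ (∀ i ≠ k, ¬ K.Reachable (corner n i) (corner n k)) ∧
    ∀ x ∈ verts n, K.Reachable x (corner n k) ∨ ∀ i ≠ k, K.Reachable x (corner n i)

lemma IsCut.reachable {n : ℕ} {k i j : Fin 3} {K : SimpleGraph (ℤ × ℤ)} (h : IsCut n k K)
    (hi : i ≠ k) (hj : j ≠ k) : K.Reachable (corner n i) (corner n j) :=
  (h.2.2.2 _ (corner_mem_verts n i)).resolve_left (h.2.2.1 i hi) j hj

/-- Replaces the count of components by reachability of corners, a form stable under permutation of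
the corners. -/
lemma isTwoForest_iff {n : ℕ} {K : SimpleGraph (ℤ × ℤ)} : IsTwoForest n K ↔ IsCut n 2 K := by
  unfold IsTwoForest IsSpanningForest
  rw [← corner_zero_right n, ← corner_one_right, ← corner_two_right]
  by_cases hle : K ≤ SG n
  swap
  · simp [IsCut, hle]
  have hS : K.support ⊆ verts n := (support_mono hle).trans (support_SG_subset n)
  rw [induce_isAcyclic_iff_of_support_subset hS]
  let v (i : Fin 3) : (K.induce (verts n)).ConnectedComponent :=
    (K.induce (verts n)).connectedComponentMk ⟨corner n i, corner_mem_verts n i⟩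
  have hv {x : ℤ × ℤ} (hx : x ∈ verts n) (i : Fin 3) :
      (K.induce (verts n)).connectedComponentMk ⟨x, hx⟩ = v i ↔ K.Reachable x (corner n i) := by
    rw [ConnectedComponent.eq, induce_reachable_iff_of_support_subset hS]
  constructor
  · rintro ⟨⟨-, ha, hc⟩, h01, h02⟩
    refine ⟨hle, ha, ?_, fun x hx => ?_⟩
    · intro i hi h
      fin_cases i
      · exact h02 h
      · exact h02 (h01.trans h)
      · exact hi rfl
    · obtain ⟨a, b, hab, hU⟩ := Nat.card_eq_two_iff.1 hc
      have hmem (c : (K.induce (verts n)).ConnectedComponent) : c = a ∨ c = b := by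
        simpa using hU.ge (Set.mem_univ c)
      have hne : v 0 ≠ v 2 := fun h => h02 ((hv (corner_mem_verts n 0) 2).1 h)
      have : (K.induce (verts n)).connectedComponentMk ⟨x, hx⟩ = v 2 ∨
          (K.induce (verts n)).connectedComponentMk ⟨x, hx⟩ = v 0 := by
        have h1 := hmem (v 0)
        have h2 := hmem (v 2)
        have h3 := hmem ((K.induce (verts n)).connectedComponentMk ⟨x, hx⟩)
        grind
      rw [hv, hv] at this
      refine this.imp_right fun h i hi => ?_
      fin_cases i
      · exact h
      · exact h.trans h01
      · exact absurd rfl hi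
  · intro h
    refine ⟨⟨hle, h.2.1, ?_⟩, h.reachable (by decide) (by decide), h.2.2.1 0 (by decide)⟩
    refine Nat.card_eq_two_iff.2 ⟨v 2, v 0, fun he => ?_, ?_⟩
    · exact h.2.2.1 0 (by decide) ((hv (corner_mem_verts n 0) 2).1 he.symm)
    · refine Set.eq_univ_of_forall fun c => ?_
      induction c using ConnectedComponent.ind with | _ x =>
      obtain ⟨x, hx⟩ := x
      rw [Set.mem_insert_iff, Set.mem_singleton_iff, hv, hv]
      exact (h.2.2.2 x hx).imp_right fun h => h 0 (by decide)

/-- Corner `i` falls into the component of one of the other two corners; the remaining one is then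
isolated from both. -/
lemma isSeparated_iff {n : ℕ} {i : Fin 3} {K : SimpleGraph (ℤ × ℤ)} :
    IsSeparated n i K ↔ ∃ k ≠ i, IsCut n k K := by
  constructor
  · rintro ⟨hle, ha, hn, hr⟩
    have key : ∀ j k, j ≠ i → k ≠ i → j ≠ k → (∀ l, l = i ∨ l = j ∨ l = k) →
        K.Reachable (corner n i) (corner n j) → IsCut n k K := by
      intro j k hj hk hjk hall hij
      refine ⟨hle, ha, fun l hl h => ?_, fun x hx => ?_⟩
      · rcases hall l with rfl | rfl | rfl
        · exact hn _ _ hj hk hjk (hij.symm.trans h)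
        · exact hn _ _ hj hk hjk h
        · exact hl rfl
      · obtain ⟨l, hl, h⟩ := hr x hx
        rcases hall l with rfl | rfl | rfl
        · exact absurd rfl hl
        · refine Or.inr fun m hm => ?_
          rcases hall m with rfl | rfl | rfl
          · exact h.trans hij.symm
          · exact h
          · exact absurd rfl hm
        · exact Or.inl h
    obtain ⟨j, k, hj, hk, hjk, hall⟩ := exists_others i
    obtain ⟨l, hl, h⟩ := hr _ (corner_mem_verts n i)
    rcases hall l with rfl | rfl | rfl
    · exact absurd rfl hl
    · exact ⟨k, hk, key _ k hj hk hjk hall h⟩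
    · exact ⟨j, hj, key _ j hk hj hjk.symm (fun m => by have := hall m; tauto) h⟩
  · rintro ⟨k, hk, h⟩
    refine ⟨h.1, h.2.1, fun l m hl hm hlm hr => ?_, fun x hx => ?_⟩
    · have : l = k ∨ m = k := by omega
      rcases this with rfl | rfl
      · exact h.2.2.1 m hlm.symm hr.symm
      · exact h.2.2.1 l hlm hr
    · obtain ⟨j, l, hj, hl, hjl, -⟩ := exists_others i
      rcases h.2.2.2 x hx with h | h
      · exact ⟨k, hk, h⟩
      · by_cases hjk : j = k
        · exact ⟨l, hl, h l (hjk ▸ hjl.symm)⟩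
        · exact ⟨j, hj, h j hjk⟩

/-- Makes the alternatives in `isSeparated_iff` exclusive, so that their counts add. -/
lemma IsCut.unique {n : ℕ} {k k' : Fin 3} {K : SimpleGraph (ℤ × ℤ)} (h : IsCut n k K)
    (h' : IsCut n k' K) : k = k' := by
  by_contra hk
  obtain ⟨l, hl, hl'⟩ : ∃ l : Fin 3, l ≠ k ∧ l ≠ k' := by
    clear h h' hk
    revert k k'
    decide
  exact h'.2.2.1 l hl' (h.reachable hl (Ne.symm hk))

lemma IsCut.not_isSpanningTree {n : ℕ} {k : Fin 3} {K : SimpleGraph (ℤ × ℤ)}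
    (h : IsCut n k K) : ¬ IsSpanningTree n K := fun ht => by
  obtain ⟨l, hl⟩ : ∃ l : Fin 3, l ≠ k := exists_ne k
  exact h.2.2.1 l hl
    ((isSpanningTree_iff.1 ht).2.2 _ (corner_mem_verts n l) _ (corner_mem_verts n k))

/-! ### Existence of spanning trees and cuts -/

lemma SG_reachable {n : ℕ} {p : ℤ × ℤ} (hp : p ∈ verts n) :
    (SG n).Reachable p (corner n 0) := by
  induction n generalizing p with
  | zero =>
    obtain ⟨i, rfl⟩ := mem_verts_zero.1 hp
    by_cases h : i = 0
    · rw [h]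
    · exact Adj.reachable (SG_zero_adj.2 ⟨(corner_injective 0).ne h, ⟨_, rfl⟩, _, rfl⟩)
  | succ n ih =>
    have hle : glue n (fun _ => SG n) ≤ SG (n + 1) := glue_le fun _ => le_rfl
    have step (i) {q} (hq : q ∈ verts n) :
        (SG (n + 1)).Reachable (q + corner n i) (corner n 0 + corner n i) :=
      (glue_reachable_add (K := fun _ => SG n) (ih hq)).mono hle
    obtain ⟨i, hi⟩ := mem_verts_succ.1 hp
    have h1 := step i hi
    -- The lower left corner of copy `i` is also corner `i` of copy `0`, from which `o` is reached.
    rw [sub_add_cancel, add_comm (corner n 0)] at h1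
    rw [corner_succ]
    exact h1.trans (step 0 (corner_mem_verts n i))

/-- The graph `SG(n)` without the edges at the topmost vertex. -/
def dropTop (n : ℕ) : SimpleGraph (ℤ × ℤ) where
  Adj p q := (SG n).Adj p q ∧ p ≠ corner n 2 ∧ q ≠ corner n 2
  symm := ⟨fun _ _ h => ⟨h.1.symm, h.2.2, h.2.1⟩⟩
  loopless := ⟨fun _ h => h.1.ne rfl⟩

/-- Only the top copy contains the removed vertex, so the induction glues `SG n`, `SG n` and
`dropTop n`. -/
lemma dropTop_reachable {n : ℕ} {p : ℤ × ℤ} (hp : p ∈ verts n) (hp2 : p ≠ corner n 2) :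
    (dropTop n).Reachable p (corner n 0) := by
  induction n generalizing p with
  | zero =>
    obtain ⟨i, rfl⟩ := mem_verts_zero.1 hp
    by_cases h : i = 0
    · rw [h]
    · exact Adj.reachable ⟨SG_zero_adj.2 ⟨(corner_injective 0).ne h, ⟨_, rfl⟩, _, rfl⟩, hp2,
        (corner_injective 0).ne (by decide)⟩
  | succ n ih =>
    have htop {i} (hi : i ≠ 2) {q} (hq : q ∈ verts n) : q + corner n i ≠ corner (n + 1) 2 := by
      intro h
      rw [corner_succ] at h
      have := eq_of_mem_copies (n := n) hi (p := q + corner n i) (by simpa using hq)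
        (by rw [h]; simpa using corner_mem_verts n 2)
      rw [h, add_left_inj] at this
      exact hi (corner_injective n this.symm)
    let K : Fin 3 → SimpleGraph (ℤ × ℤ) := ![SG n, SG n, dropTop n]
    have hle : glue n K ≤ dropTop (n + 1) := by
      rintro a b ⟨i, h⟩
      by_cases hi : i = 2
      · subst hi
        have h : (dropTop n).Adj _ _ := h
        refine ⟨SG_succ_adj.2 ⟨2, h.1⟩, ?_, ?_⟩ <;> rintro rfl
        · exact h.2.1 (by simp [corner_succ])
        · exact h.2.2 (by simp [corner_succ])
      · have h : (SG n).Adj (a - corner n i) (b - corner n i) := by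
          fin_cases i
          · exact h
          · exact h
          · exact absurd rfl hi
        refine ⟨SG_succ_adj.2 ⟨i, h⟩, ?_, ?_⟩
        · simpa using htop hi (support_SG_subset n ⟨_, h⟩)
        · simpa using htop hi (support_SG_subset n ⟨_, h.symm⟩)
    have step (i) {q} (hq : q ∈ verts n) (hq2 : i = 2 → q ≠ corner n 2) :
        (dropTop (n + 1)).Reachable (q + corner n i) (corner n 0 + corner n i) := by
      refine (glue_reachable_add (K := K) ?_).mono hle
      fin_cases i
      · exact SG_reachable hq
      · exact SG_reachable hq
      · exact ih hq (hq2 rfl)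
    obtain ⟨i, hi⟩ := mem_verts_succ.1 hp
    have h1 := step i hi (by rintro rfl h; exact hp2 (by rw [corner_succ, ← sub_eq_iff_eq_add, h]))
    rw [sub_add_cancel, add_comm (corner n 0)] at h1
    rw [corner_succ]
    exact h1.trans (step 0 (corner_mem_verts n i) (by simp))

lemma exists_isSpanningTree (n : ℕ) : ∃ K, IsSpanningTree n K := by
  obtain ⟨T, hle, ha, hr⟩ := (SG n).exists_isAcyclic_reachable_eq_le
  refine ⟨T, isSpanningTree_iff.2 ⟨hle, ha, fun x hx y hy => ?_⟩⟩
  rw [hr]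
  exact (SG_reachable hx).trans (SG_reachable hy).symm

lemma exists_isCut (n : ℕ) : ∃ K, IsCut n 2 K := by
  -- A spanning forest of the graph without its top edges has `b_n` alone as one component.
  obtain ⟨T, hle, ha, hr⟩ := (dropTop n).exists_isAcyclic_reachable_eq_le
  refine ⟨T, fun _ _ h => (hle h).1, ha, fun i hi h => ?_, fun x hx => ?_⟩
  · have hS : T.support ⊆ {corner n 2}ᶜ := by
      rintro p ⟨q, h⟩
      exact (hle h).2.1
    exact h.mem_of_support_subset hS ((corner_injective n).ne hi) rfl
  · by_cases h : x = corner n 2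
    · exact Or.inl (by rw [h])
    · refine Or.inr fun i hi => ?_
      rw [hr]
      exact (dropTop_reachable hx h).trans
        (dropTop_reachable (corner_mem_verts n i) ((corner_injective n).ne hi)).symm

/-! ### Symmetries of the gasket -/

/-- Barycentric coordinates with respect to the corners of `SG(n)`, scaled to have sum `2 ^ n`. -/
def bary (n : ℕ) (p : ℤ × ℤ) : Fin 3 → ℤ := ![2 ^ n - p.1 - p.2, p.1, p.2]

/-- The affine map that permutes the corners of `SG(n)` by `π`. -/
def sym (n : ℕ) (π : Equiv.Perm (Fin 3)) (p : ℤ × ℤ) : ℤ × ℤ :=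
  (bary n p (π⁻¹ 1), bary n p (π⁻¹ 2))

lemma bary_injective (n : ℕ) : Function.Injective (bary n) := fun _ _ h =>
  Prod.ext (congrFun h 1) (congrFun h 2)

lemma sum_bary (n : ℕ) (p : ℤ × ℤ) : ∑ i, bary n p i = 2 ^ n := by
  simp only [Fin.sum_univ_three, bary, Matrix.cons_val]
  ring

/-- `sym` records only coordinates `1` and `2`; coordinate `0` follows because the sum is `2 ^ n`.
-/
lemma bary_sym (n : ℕ) (π : Equiv.Perm (Fin 3)) (p : ℤ × ℤ) (i : Fin 3) :
    bary n (sym n π p) i = bary n p (π⁻¹ i) := by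
  have h : ∑ i, bary n p (π⁻¹ i) = 2 ^ n := by
    rw [Equiv.sum_comp π⁻¹ (bary n p), sum_bary]
  rw [Fin.sum_univ_three] at h
  fin_cases i
  · simp only [bary, sym] at h ⊢
    simp only [Fin.zero_eta, Matrix.cons_val_zero]
    linarith
  · rfl
  · rfl

lemma bary_add_corner (n : ℕ) (p : ℤ × ℤ) (d i : Fin 3) :
    bary (n + 1) (p + corner n d) i = bary n p i + if i = d then 2 ^ n else 0 := by
  fin_cases d <;> fin_cases i <;> simp [bary, corner, subOffset, pow_succ] <;> ring

lemma bary_corner (n : ℕ) (d i : Fin 3) :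
    bary n (corner n d) i = if i = d then 2 ^ n else 0 := by
  fin_cases d <;> fin_cases i <;> simp [bary, corner, subOffset]

/-- A symmetry carries copy `d` to copy `π d` and acts on it as the same symmetry one stage lower.
Inductions on the stage or the address rest on this. -/
lemma sym_add_corner (n : ℕ) (π : Equiv.Perm (Fin 3)) (p : ℤ × ℤ) (d : Fin 3) :
    sym (n + 1) π (p + corner n d) = sym n π p + corner n (π d) := by
  refine bary_injective (n + 1) (funext fun i => ?_)
  simp only [bary_sym, bary_add_corner, Equiv.Perm.inv_eq_iff_eq]

lemma sym_corner (n : ℕ) (π : Equiv.Perm (Fin 3)) (d : Fin 3) :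
    sym n π (corner n d) = corner n (π d) := by
  refine bary_injective n (funext fun i => ?_)
  simp only [bary_sym, bary_corner, Equiv.Perm.inv_eq_iff_eq]

lemma sym_sym_inv (n : ℕ) (π : Equiv.Perm (Fin 3)) (p : ℤ × ℤ) :
    sym n π (sym n π⁻¹ p) = p := by
  refine bary_injective n (funext fun i => ?_)
  simp [bary_sym]

/-- `sym` as a bijection. -/
def symEquiv (n : ℕ) (π : Equiv.Perm (Fin 3)) : ℤ × ℤ ≃ ℤ × ℤ where
  toFun := sym n π
  invFun := sym n π⁻¹
  left_inv p := by simpa using sym_sym_inv n π⁻¹ p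
  right_inv p := sym_sym_inv n π p

lemma sym_sub_corner (n : ℕ) (π : Equiv.Perm (Fin 3)) (p : ℤ × ℤ) (d : Fin 3) :
    sym (n + 1) π p - corner n (π d) = sym n π (p - corner n d) := by
  rw [sub_eq_iff_eq_add, ← sym_add_corner, sub_add_cancel]

lemma sym_mem_verts {n : ℕ} (π : Equiv.Perm (Fin 3)) {p : ℤ × ℤ} (hp : p ∈ verts n) :
    sym n π p ∈ verts n := by
  induction n generalizing p with
  | zero =>
    obtain ⟨i, rfl⟩ := mem_verts_zero.1 hp
    rw [sym_corner]
    exact corner_mem_verts 0 _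
  | succ n ih =>
    obtain ⟨i, hi⟩ := mem_verts_succ.1 hp
    exact mem_verts_succ.2 ⟨π i, by rw [sym_sub_corner]; exact ih hi⟩

lemma sym_SG_adj {n : ℕ} (π : Equiv.Perm (Fin 3)) {p q : ℤ × ℤ} (h : (SG n).Adj p q) :
    (SG n).Adj (sym n π p) (sym n π q) := by
  induction n generalizing p q with
  | zero =>
    obtain ⟨hne, ⟨i, rfl⟩, j, rfl⟩ := SG_zero_adj.1 h
    exact SG_zero_adj.2 ⟨(symEquiv 0 π).injective.ne hne, ⟨_, sym_corner ..⟩, _, sym_corner ..⟩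
  | succ n ih =>
    obtain ⟨i, hi⟩ := SG_succ_adj.1 h
    exact SG_succ_adj.2 ⟨π i, by rw [sym_sub_corner, sym_sub_corner]; exact ih hi⟩

lemma comap_sym_le {n : ℕ} {π : Equiv.Perm (Fin 3)} {K : SimpleGraph (ℤ × ℤ)} (hK : K ≤ SG n) :
    K.comap (sym n π) ≤ SG n := by
  intro p q h
  simpa [show ∀ p, sym n π⁻¹ (sym n π p) = p from (symEquiv n π).left_inv] using
    sym_SG_adj π⁻¹ (hK h)

/-- The reflected graph is isomorphic to the original one. -/
def comapSymIso (n : ℕ) (π : Equiv.Perm (Fin 3)) (K : SimpleGraph (ℤ × ℤ)) :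
    K.comap (sym n π) ≃g K := Iso.comap (symEquiv n π) K

lemma comap_sym_reachable {n : ℕ} {π : Equiv.Perm (Fin 3)} {K : SimpleGraph (ℤ × ℤ)}
    {p q : ℤ × ℤ} :
    (K.comap (sym n π)).Reachable p q ↔ K.Reachable (sym n π p) (sym n π q) :=
  (Iso.reachable_iff (φ := comapSymIso n π K)).symm

lemma deg_comap_sym (n : ℕ) (π : Equiv.Perm (Fin 3)) (K : SimpleGraph (ℤ × ℤ)) (x : ℤ × ℤ) :
    deg (K.comap (sym n π)) x = deg K (sym n π x) := by
  have : K.neighborSet (sym n π x) = symEquiv n π '' (K.comap (sym n π)).neighborSet x := by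
    ext y
    rw [Equiv.image_eq_preimage_symm]
    change K.Adj _ _ ↔ K.Adj (sym n π x) (symEquiv n π ((symEquiv n π).symm y))
    rw [Equiv.apply_symm_apply]
  rw [deg, deg, this, Set.ncard_image_of_injective _ (symEquiv n π).injective]

lemma IsSpanningTree.comap_sym {n : ℕ} {π : Equiv.Perm (Fin 3)} {K : SimpleGraph (ℤ × ℤ)}
    (h : IsSpanningTree n K) : IsSpanningTree n (K.comap (sym n π)) := by
  obtain ⟨hle, ha, hr⟩ := isSpanningTree_iff.1 h
  refine isSpanningTree_iff.2 ⟨comap_sym_le hle, (comapSymIso n π K).isAcyclic_iff.2 ha, ?_⟩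
  exact fun x hx y hy => comap_sym_reachable.2 (hr _ (sym_mem_verts π hx) _ (sym_mem_verts π hy))

lemma IsCut.comap_sym {n : ℕ} {π : Equiv.Perm (Fin 3)} {k : Fin 3} {K : SimpleGraph (ℤ × ℤ)}
    (h : IsCut n (π k) K) : IsCut n k (K.comap (sym n π)) := by
  obtain ⟨hle, ha, hn, hr⟩ := h
  refine ⟨comap_sym_le hle, (comapSymIso n π K).isAcyclic_iff.2 ha, fun i hi h => ?_,
    fun x hx => ?_⟩
  · rw [comap_sym_reachable, sym_corner, sym_corner] at h
    exact hn _ (π.injective.ne hi) h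
  · simp only [comap_sym_reachable, sym_corner]
    exact (hr _ (sym_mem_verts π hx)).imp_right fun h i hi => h _ (π.injective.ne hi)

lemma ncard_eq_of_comap_sym {n : ℕ} (π : Equiv.Perm (Fin 3))
    {P Q : SimpleGraph (ℤ × ℤ) → Prop} (h : ∀ K, P K → Q (K.comap (sym n π)))
    (h' : ∀ K, Q K → P (K.comap (sym n π⁻¹))) : {K | P K}.ncard = {K | Q K}.ncard := by
  have hinv (π : Equiv.Perm (Fin 3)) (K : SimpleGraph (ℤ × ℤ)) :
      (K.comap (sym n π⁻¹)).comap (sym n π) = K := by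
    ext p q
    simp [show ∀ p, sym n π⁻¹ (sym n π p) = p from (symEquiv n π).left_inv]
  refine Set.ncard_congr (fun K _ => K.comap (sym n π)) h ?_ ?_
  · intro K L _ _ hKL
    rw [← hinv π⁻¹ K, inv_inv, hKL]
    simpa using hinv π⁻¹ L
  · exact fun K hK => ⟨K.comap (sym n π⁻¹), h' K hK, hinv π K⟩

/-! ### Degree counts under symmetry -/

/-- The number of spanning trees with `j` edges at `x`. -/
noncomputable def treeCount (n j : ℕ) (x : ℤ × ℤ) : ℕ :=
  {K | IsSpanningTree n K ∧ deg K x = j}.ncard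

/-- The number of two-component forests isolating the `k`-th corner, with `j` edges at `x`. -/
noncomputable def cutCount (n : ℕ) (k : Fin 3) (j : ℕ) (x : ℤ × ℤ) : ℕ :=
  {K | IsCut n k K ∧ deg K x = j}.ncard

lemma treeCount_sym (n : ℕ) (π : Equiv.Perm (Fin 3)) (j : ℕ) (x : ℤ × ℤ) :
    treeCount n j (sym n π x) = treeCount n j x := by
  refine ncard_eq_of_comap_sym π (fun K hK => ⟨hK.1.comap_sym, ?_⟩)
    (fun K hK => ⟨hK.1.comap_sym, ?_⟩)
  · rw [deg_comap_sym, hK.2]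
  · rw [deg_comap_sym, show sym n π⁻¹ (sym n π x) = x from (symEquiv n π).left_inv x, hK.2]

lemma cutCount_sym (n : ℕ) (π : Equiv.Perm (Fin 3)) (k : Fin 3) (j : ℕ) (x : ℤ × ℤ) :
    cutCount n (π k) j (sym n π x) = cutCount n k j x := by
  refine ncard_eq_of_comap_sym π (fun K hK => ⟨hK.1.comap_sym, ?_⟩)
    (fun K hK => ⟨IsCut.comap_sym (by simpa using hK.1), ?_⟩)
  · rw [deg_comap_sym, hK.2]
  · rw [deg_comap_sym, show sym n π⁻¹ (sym n π x) = x from (symEquiv n π).left_inv x, hK.2]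

lemma ncard_isCut (n : ℕ) (k : Fin 3) : {K | IsCut n k K}.ncard = {K | IsCut n 2 K}.ncard := by
  refine ncard_eq_of_comap_sym (n := n) (Equiv.swap 2 k) (fun K hK => IsCut.comap_sym ?_)
    (fun K hK => IsCut.comap_sym ?_) <;> simpa using hK

lemma tilde_eq_sym (n : ℕ) (p : ℤ × ℤ) : tilde p = sym n (Equiv.swap 1 2) p := by
  simp [tilde, sym, bary]

lemma hat_eq_sym (n : ℕ) (p : ℤ × ℤ) : hat n p = sym n (Equiv.swap 0 2) p := by
  have : Equiv.swap (0 : Fin 3) 2 1 = 1 := by decide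
  simp [hat, sym, bary, this]

/-! ### Vertices given by addresses -/

lemma vertex_cons (x d : Fin 3) (m : ℕ) (γ : List (Fin 3)) :
    vertex x (m + 1) (d :: γ) = vertex x m γ + corner (m + 1) d := by
  rw [vertex, corner, add_comm]

/-- Each digit names a corner and is permuted as such. A letter names a side, that is, a pair of
corners; exchanging corners `0` and `1`, for instance, fixes the bottom side and exchanges left and
right. -/
lemma sym_vertex (t x : Fin 3) {m : ℕ} {γ : List (Fin 3)} (h : γ.length ≤ m) :
    sym (m + 1) (digitPerm t) (vertex x m γ) =
      vertex (letterPerm t x) m (γ.map (digitPerm t)) := by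
  induction γ generalizing m with
  | nil =>
    have h1 : Equiv.swap (0 : Fin 3) 1 2 = 2 := by decide
    have h2 : Equiv.swap (1 : Fin 3) 2 0 = 0 := by decide
    fin_cases t <;> fin_cases x <;>
      simp [vertex, sym, bary, digitPerm, letterPerm, sideMid, pow_succ, h1, h2] <;> ring
  | cons d γ ih =>
    obtain _ | m := m
    · simp at h
    · rw [List.map_cons, vertex_cons, vertex_cons, sym_add_corner, ih (by simpa using h)]

lemma vertex_mem_verts (x : Fin 3) {m : ℕ} {γ : List (Fin 3)} (h : γ.length ≤ m) :
    vertex x m γ ∈ verts (m + 1) := by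
  induction γ generalizing m with
  | nil =>
    obtain ⟨i, j, hx⟩ : ∃ i j, vertex x m [] = corner m i + corner m j := by
      fin_cases x
      · exact ⟨0, 1, by simp [vertex, corner, sideMid, subOffset]⟩
      · exact ⟨0, 2, by simp [vertex, corner, sideMid, subOffset]⟩
      · exact ⟨1, 2, by simp [vertex, corner, sideMid, subOffset]⟩
    rw [hx]
    exact mem_verts_succ.2 ⟨j, by simpa using corner_mem_verts m i⟩
  | cons d γ ih =>
    obtain _ | m := m
    · simp at h
    · rw [vertex_cons]
      exact mem_verts_succ.2 ⟨d, by simpa using ih (by simpa using h)⟩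

/-- Ensures that all edges at the vertex lie in a single copy, as `deg_part` requires. -/
lemma vertex_ne_corner (x i : Fin 3) {m : ℕ} {γ : List (Fin 3)} (h : γ.length ≤ m) :
    vertex x m γ ≠ corner (m + 1) i := by
  induction γ generalizing m with
  | nil =>
    fin_cases x <;> fin_cases i <;> simp [vertex, corner, sideMid, subOffset, pow_succ]
  | cons d γ ih =>
    obtain _ | m := m
    · simp at h
    · have hm : γ.length ≤ m := by simpa using h
      rw [vertex_cons, corner_succ (m + 1)]
      intro he
      by_cases hd : d = i
      · rw [hd, add_left_inj] at he
        exact ih hm he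
      · have := eq_of_mem_copies (n := m + 1) hd (p := corner (m + 1) i + corner (m + 1) i)
          (by rw [← he]; simpa using vertex_mem_verts x hm)
          (by simpa using corner_mem_verts (m + 1) i)
        rw [add_left_inj] at this
        exact hd (corner_injective _ this.symm)

/-! ### Counting spanning trees of the next stage -/

lemma ncard_univ_pi {α : Type*} (A : Fin 3 → Set α) :
    (Set.univ.pi A).ncard = (A 0).ncard * (A 1).ncard * (A 2).ncard := by
  rw [← Nat.card_coe_set_eq, Nat.card_congr (Equiv.Set.univPi A), Nat.card_pi,
    Fin.prod_univ_three]
  simp only [Nat.card_coe_set_eq]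

/-- The set is a union over `i` of three boxes, disjoint because coordinate `i` lies in `S i` for
one box and in `T i` for the others. -/
lemma ncard_exists_mem_forall_ne_mem {α : Type*} {S T : Fin 3 → Set α} (hS : ∀ i, (S i).Finite)
    (hT : ∀ i, (T i).Finite) (hST : ∀ i, Disjoint (S i) (T i)) :
    {K : Fin 3 → α | ∃ i, K i ∈ S i ∧ ∀ j ≠ i, K j ∈ T j}.ncard =
      (S 0).ncard * (T 1).ncard * (T 2).ncard + (T 0).ncard * (S 1).ncard * (T 2).ncard +
        (T 0).ncard * (T 1).ncard * (S 2).ncard := by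
  have hmem (i : Fin 3) (K : Fin 3 → α) :
      K ∈ Set.univ.pi (Function.update T i (S i)) ↔ K i ∈ S i ∧ ∀ j ≠ i, K j ∈ T j := by
    constructor
    · intro h
      exact ⟨by simpa using h i trivial, fun j hj => by simpa [hj] using h j trivial⟩
    · rintro ⟨h, h'⟩ j -
      by_cases hj : j = i
      · subst hj
        simpa using h
      · simpa [hj] using h' j hj
  have hU : {K : Fin 3 → α | ∃ i, K i ∈ S i ∧ ∀ j ≠ i, K j ∈ T j} =
      ⋃ i, Set.univ.pi (Function.update T i (S i)) := by
    ext K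
    simp only [Set.mem_ofPred_eq, Set.mem_iUnion, hmem]
  rw [hU, Set.ncard_iUnion_of_finite, finsum_eq_sum_of_fintype, Fin.sum_univ_three]
  · simp [ncard_univ_pi]
  · intro i
    refine Set.Finite.pi fun j => ?_
    by_cases hj : j = i
    · subst hj
      simpa using hS j
    · simpa [hj] using hT j
  · intro i j hij
    refine Set.disjoint_left.2 fun K hi hj => ?_
    exact Set.disjoint_left.1 (hST i) ((hmem i K).1 hi).1 (((hmem j K).1 hj).2 i hij)

lemma finite_cuts (n : ℕ) (k : Fin 3) (D : SimpleGraph (ℤ × ℤ) → Prop) :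
    {K | IsCut n k K ∧ D K}.Finite :=
  (finite_le_SG n).subset fun _ h => h.1.1

lemma ncard_isSeparated (n : ℕ) {i j k : Fin 3} (hj : j ≠ i) (hk : k ≠ i) (hjk : j ≠ k)
    (D : SimpleGraph (ℤ × ℤ) → Prop) :
    {K | IsSeparated n i K ∧ D K}.ncard =
      {K | IsCut n j K ∧ D K}.ncard + {K | IsCut n k K ∧ D K}.ncard := by
  rw [← Set.ncard_union_eq _ (finite_cuts n j D) (finite_cuts n k D)]
  · congr 1
    ext K
    simp only [Set.mem_ofPred_eq, Set.mem_union, isSeparated_iff, ← or_and_right]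
    refine and_congr_left fun _ => ⟨?_, ?_⟩
    · rintro ⟨l, hl, h⟩
      have : l = j ∨ l = k := by omega
      rcases this with rfl | rfl
      · exact Or.inl h
      · exact Or.inr h
    · rintro (h | h)
      · exact ⟨j, hj, h⟩
      · exact ⟨k, hk, h⟩
  · exact Set.disjoint_left.2 fun K h h' => hjk (h.1.unique h'.1)

/-- The number of spanning trees of `SG(n + 1)` whose restriction to the right copy of `SG(n)` has
a given property. -/
lemma ncard_spanningTrees_succ (n : ℕ) (D : SimpleGraph (ℤ × ℤ) → Prop) :
    {K | IsSpanningTree (n + 1) K ∧ D (part n K 1)}.ncard =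
      {K | IsSpanningTree n K}.ncard ^ 2 *
        ({K | IsCut n 0 K ∧ D K}.ncard + {K | IsCut n 2 K ∧ D K}.ncard) +
      4 * {K | IsSpanningTree n K}.ncard * {K | IsCut n 2 K}.ncard *
        {K | IsSpanningTree n K ∧ D K}.ncard := by
  -- The condition `D` is imposed on the right copy only, whichever copy is the broken one.
  let S : Fin 3 → Set (SimpleGraph (ℤ × ℤ)) := fun i => {K | IsSeparated n i K ∧ (i = 1 → D K)}
  let T : Fin 3 → Set (SimpleGraph (ℤ × ℤ)) := fun i => {K | IsSpanningTree n K ∧ (i = 1 → D K)}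
  have hle {K : Fin 3 → SimpleGraph (ℤ × ℤ)} (hK : ∃ i, K i ∈ S i ∧ ∀ j ≠ i, K j ∈ T j) (l) :
      K l ≤ SG n := by
    obtain ⟨i, hi, hj⟩ := hK
    by_cases hl : l = i
    · subst hl
      exact hi.1.1
    · exact (hj l hl).1.1
  have hD {K : Fin 3 → SimpleGraph (ℤ × ℤ)} : (∃ i, K i ∈ S i ∧ ∀ j ≠ i, K j ∈ T j) ↔
      (∃ i, IsSeparated n i (K i) ∧ ∀ j ≠ i, IsSpanningTree n (K j)) ∧ D (K 1) := by
    constructor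
    · rintro ⟨i, hi, hj⟩
      refine ⟨⟨i, hi.1, fun j h => (hj j h).1⟩, ?_⟩
      by_cases h : 1 = i
      · subst h
        exact hi.2 rfl
      · exact (hj 1 h).2 rfl
    · rintro ⟨⟨i, hi, hj⟩, h⟩
      exact ⟨i, ⟨hi, by rintro rfl; exact h⟩, fun j hji => ⟨hj j hji, by rintro rfl; exact h⟩⟩
  have hcount : {K : Fin 3 → SimpleGraph (ℤ × ℤ) | ∃ i, K i ∈ S i ∧ ∀ j ≠ i, K j ∈ T j}.ncard =
      {K | IsSpanningTree (n + 1) K ∧ D (part n K 1)}.ncard := by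
    refine Set.ncard_congr (fun K _ => glue n K) ?_ ?_ ?_
    · intro K hK
      refine ⟨(isSpanningTree_glue_iff (hle hK)).2 (hD.1 hK).1, ?_⟩
      rw [part_glue (hle hK)]
      exact (hD.1 hK).2
    · intro K L hK hL h
      rw [← part_glue (hle hK), h, part_glue (hle hL)]
    · rintro K ⟨hK, hd⟩
      refine ⟨part n K, hD.2 ⟨?_, hd⟩, glue_part hK.1⟩
      rw [← isSpanningTree_glue_iff (part_le K), glue_part hK.1]
      exact hK
  have hdisj (i) : Disjoint (S i) (T i) := by
    refine Set.disjoint_left.2 fun K hS hT => ?_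
    obtain ⟨k, -, hk⟩ := isSeparated_iff.1 hS.1
    exact hk.not_isSpanningTree hT.1
  -- Either junction corner of the broken copy may be the isolated one, and by symmetry each choice
  -- gives the same count. Copies `0` and `2` together produce the factor `4`.
  have hS0 : (S 0).ncard = 2 * {K | IsCut n 2 K}.ncard := by
    have := ncard_isSeparated n (i := 0) (j := 1) (k := 2) (by decide) (by decide) (by decide)
      (fun _ => True)
    simp only [and_true, ncard_isCut n 1] at this
    simp only [S, zero_ne_one, false_imp_iff, and_true, this]
    ring
  have hS2 : (S 2).ncard = 2 * {K | IsCut n 2 K}.ncard := by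
    have := ncard_isSeparated n (i := 2) (j := 0) (k := 1) (by decide) (by decide) (by decide)
      (fun _ => True)
    simp only [and_true, ncard_isCut n 1, ncard_isCut n 0] at this
    simp only [S, show (2 : Fin 3) ≠ 1 by decide, false_imp_iff, and_true, this]
    ring
  have hS1 : (S 1).ncard =
      {K | IsCut n 0 K ∧ D K}.ncard + {K | IsCut n 2 K ∧ D K}.ncard := by
    rw [← ncard_isSeparated n (i := 1) (by decide) (by decide) (by decide)]
    simp [S]
  have hT0 : (T 0).ncard = {K | IsSpanningTree n K}.ncard := by simp [T]
  have hT1 : (T 1).ncard = {K | IsSpanningTree n K ∧ D K}.ncard := by simp [T]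
  have hT2 : (T 2).ncard = {K | IsSpanningTree n K}.ncard := by simp [T]
  rw [← hcount, ncard_exists_mem_forall_ne_mem (fun i => (finite_le_SG n).subset fun _ h => h.1.1)
    (fun i => (finite_le_SG n).subset fun _ h => h.1.1) hdisj, hS0, hS1, hS2, hT0, hT1, hT2]
  ring

/-- A point of a copy that is not a corner of it belongs to no other copy, so its edges all lie in
this one. -/
lemma deg_part {n : ℕ} {K : SimpleGraph (ℤ × ℤ)} (hK : K ≤ SG (n + 1)) {i : Fin 3} {x : ℤ × ℤ}
    (hx : x ∈ verts n) (hxc : ∀ j, x ≠ corner n j) :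
    deg K (x + corner n i) = deg (part n K i) x := by
  have h : K.neighborSet (x + corner n i) =
      (fun p => p + corner n i) '' (part n K i).neighborSet x := by
    ext y
    constructor
    · intro hy
      obtain ⟨j, hj⟩ := SG_succ_adj.1 (hK hy)
      have hij : i = j := by
        by_contra hij
        have := eq_of_mem_copies (n := n) hij (p := x + corner n i) (by simpa using hx)
          (support_SG_subset n ⟨_, hj⟩)
        rw [add_comm, add_right_inj] at this
        exact hxc j this
      subst hij
      refine ⟨y - corner n i, ⟨by simpa using hj, ?_⟩, sub_add_cancel ..⟩
      simpa using hy
    · rintro ⟨z, hz, rfl⟩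
      exact hz.2
  rw [deg, deg, h, Set.ncard_image_of_injective _ (add_left_injective _)]

lemma treeCount_succ {n : ℕ} (j : ℕ) {x : ℤ × ℤ} (hx : x ∈ verts n)
    (hxc : ∀ j, x ≠ corner n j) :
    treeCount (n + 1) j (x + corner n 1) =
      {K | IsSpanningTree n K}.ncard ^ 2 * (cutCount n 0 j x + cutCount n 2 j x) +
        4 * {K | IsSpanningTree n K}.ncard * {K | IsCut n 2 K}.ncard * treeCount n j x := by
  refine Eq.trans ?_ (ncard_spanningTrees_succ n (fun K => deg K x = j))
  refine congrArg Set.ncard (Set.ext fun K => ?_)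
  exact and_congr_right fun hK => by rw [deg_part hK.1 hx hxc]

lemma ncard_isSpanningTree_succ (n : ℕ) :
    {K | IsSpanningTree (n + 1) K}.ncard =
      6 * {K | IsSpanningTree n K}.ncard ^ 2 * {K | IsCut n 2 K}.ncard := by
  have h := ncard_spanningTrees_succ n (fun _ => True)
  simp only [and_true, ncard_isCut n 0] at h
  rw [h]
  ring

lemma ncard_isSpanningTree_ne_zero (n : ℕ) : {K | IsSpanningTree n K}.ncard ≠ 0 := by
  have h : {K | IsSpanningTree n K}.Finite := (finite_le_SG n).subset fun _ h => h.1
  rw [Ne, Set.ncard_eq_zero h]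
  exact Set.Nonempty.ne_empty (exists_isSpanningTree n)

lemma ncard_isCut_ne_zero (n : ℕ) : {K | IsCut n 2 K}.ncard ≠ 0 := by
  have h : {K | IsCut n 2 K}.Finite := (finite_le_SG n).subset fun _ h => h.1
  rw [Ne, Set.ncard_eq_zero h]
  exact Set.Nonempty.ne_empty (exists_isCut n)

/-! ### The recursion for the degree probabilities -/

lemma F_eq (j n : ℕ) (x : ℤ × ℤ) :
    F j n x = treeCount n j x / {K | IsSpanningTree n K}.ncard := rfl

lemma G_eq (j n : ℕ) (x : ℤ × ℤ) :
    G j n x = cutCount n 2 j x / {K | IsCut n 2 K}.ncard := by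
  simp only [G, isTwoForest_iff, cutCount]

/-- The coefficients are `4 f g · f` and `f² · g` divided by the total `6 f² g`. -/
lemma F_succ {n : ℕ} (j : ℕ) {x : ℤ × ℤ} (hx : x ∈ verts n) (hxc : ∀ j, x ≠ corner n j) :
    F j (n + 1) (x + corner n 1) = 2 / 3 * F j n x +
      1 / 6 * (cutCount n 0 j x / {K | IsCut n 2 K}.ncard) +
      1 / 6 * (cutCount n 2 j x / {K | IsCut n 2 K}.ncard) := by
  have hf : ({K | IsSpanningTree n K}.ncard : ℚ) ≠ 0 := by
    exact_mod_cast ncard_isSpanningTree_ne_zero n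
  have hg : ({K | IsCut n 2 K}.ncard : ℚ) ≠ 0 := by exact_mod_cast ncard_isCut_ne_zero n
  rw [F_eq, F_eq, treeCount_succ j hx hxc, ncard_isSpanningTree_succ]
  push_cast
  field_simp
  ring

end Gasket

open Gasket in
/-- Here `γ = (n, 1, t, γ₄, …, γ_s)` with `t = γ₃`, `δ = (γ₄, …, γ_s)` and `s = δ.length + 3`. -/
theorem mainTheorem7 (n : ℕ) (hn : 2 ≤ n) (t : Fin 3) (δ : List (Fin 3))
    (hδ : δ.length + 3 ≤ n + 1) (j : ℕ) (hj : 1 ≤ j ∧ j ≤ 4) :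
    (fun x : Fin 3 => Gasket.F j (n + 1) (Gasket.vertex x n (1 :: t :: δ))) =
      ((Gasket.B j n (n - 1) (1 :: δ.map (Gasket.digitPerm t))).submatrix
          (Gasket.letterPerm t) id * Gasket.E t * Gasket.R).mulVec Gasket.e₁ := by
  obtain ⟨m, rfl⟩ : ∃ m, n = m + 1 := ⟨n - 1, by omega⟩
  have hlen : (t :: δ).length ≤ m := by simp; omega
  funext x
  set p := vertex x m (t :: δ) with hp
  set g : ℚ := ({K | IsCut (m + 1) 2 K}.ncard : ℚ) with hg
  have hv : vertex (letterPerm t x) m (1 :: δ.map (digitPerm t)) =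
      sym (m + 1) (digitPerm t) p := by
    -- The reflection is chosen to send digit `t` to `1`.
    rw [hp, sym_vertex t x hlen, List.map_cons, show digitPerm t t = 1 by clear * -; decide +revert]
  rw [vertex_cons, F_succ j (vertex_mem_verts x hlen) fun i => vertex_ne_corner x i hlen, ← hp,
    ← hg]
  -- Reflecting the point also moves the isolated corner, from `k` to `digitPerm t k`.
  have hcut (k k' : Fin 3) (hk : digitPerm t k = k') :
      cutCount (m + 1) k' j (sym (m + 1) (digitPerm t) p) = cutCount (m + 1) k j p := by
    rw [← hk, cutCount_sym]
  have hF : F j (m + 1) (sym (m + 1) (digitPerm t) p) = F j (m + 1) p := by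
    rw [F_eq, F_eq, treeCount_sym]
  have hcut' (π : Equiv.Perm (Fin 3)) (k : Fin 3) (hk : π k = 2) (v : ℤ × ℤ) :
      G j (m + 1) (sym (m + 1) π v) = cutCount (m + 1) k j v / g := by
    rw [G_eq, hg, ← cutCount_sym (m + 1) π k, hk]
  have hG (v : ℤ × ℤ) : G j (m + 1) v = cutCount (m + 1) 2 j v / g := G_eq ..
  have htilde (v : ℤ × ℤ) : G j (m + 1) (tilde v) = cutCount (m + 1) 1 j v / g := by
    rw [tilde_eq_sym (m + 1), hcut' _ 1 (by decide)]
  have hhat (v : ℤ × ℤ) : G j (m + 1) (hat (m + 1) v) = cutCount (m + 1) 0 j v / g := by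
    rw [hat_eq_sym, hcut' _ 0 (by decide)]
  simp only [Matrix.mulVec, dotProduct, Matrix.mul_apply, Matrix.submatrix_apply, B,
    Nat.add_sub_cancel, hv, htilde, hhat, hG, hF, Fin.sum_univ_five, Matrix.of_apply, id]
  generalize sym (m + 1) (digitPerm t) p = q at hcut
  clear_value p
  -- The columns `G`, `tilde`, `hat` of `B` isolate corners `2`, `1`, `0`. The recursion needs
  -- corners `0` and `2` at `p`. At `q` these become `1, 2` for `t = 0`, stay `0, 2` for `t = 1`,
  -- and become `0, 1` for `t = 2`, which are the columns selected by `E t * R` applied to `e₁`.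
  fin_cases t
  · have h0 := hcut 0 1 (by decide)
    have h2 := hcut 2 2 (by decide)
    simp [E, R, e₁, h0, h2]
    ring
  · have h0 := hcut 0 0 (by decide)
    have h2 := hcut 2 2 (by decide)
    simp [E, R, e₁, h0, h2]
    ring
  · have h0 := hcut 0 0 (by decide)
    have h2 := hcut 2 1 (by decide)
    simp [E, R, e₁, h0, h2]
    ring
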